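/- Let $\alpha,\beta>0$ be real numbers, let $k\ge 1$ be an integer, let $g(n)=\sum_{i=0}^{k}c_i n^i$ be a polynomial of degree exactly $k$ with complex coefficients (so $c_k\ne 0$), and let $x$ be a sequence of complex numbers satisfying \[ x(n)=\alpha\, x\bigl(\lfloor n/2\rfloor\bigr)+\beta\, x\bigl(\lceil n/2\rceil\bigr)+g(n)\qquad\text{for all integers } n\ge 2, \] where $x(1)$ is arbitrary. Write $\{z\}=z-\lfloor z\rfloor$ for the fractional part of a real number $z$, and $[S]=1$ if the statement $S$ is true, $[S]=0$ otherwise. Then, as $n\to\infty$, the following hold. In each case the assertion is that there exist continuous $1$-periodic functions $\Phi$ (and $\Psi$, where it occurs) from $\mathbb{R}$ to $\mathbb{C}$ with the stated property; in Cases 2 and 3 these functions do not depend on $\varepsilon$, whereas the implied constant may. Case 1a. If $\alpha+\beta>2^k$ and $2^k>\max\{\alpha,\beta\}$, then \[ x(n)=n^{\log_2(\alpha+\beta)}\,\Phi(\{\log_2 n\})+n^k\,\Psi(\{\log_2 n\})+O\bigl(n^{\log_2\max\{\alpha,\beta\}}\bigr). \] Case 1b. If $\alpha+\beta>2^k$ and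 $\max\{\alpha,\beta\}\ge 2^k$, then \[ x(n)=n^{\log_2(\alpha+\beta)}\,\Phi(\{\log_2 n\})+O\bigl(n^{\log_2\max\{\alpha,\beta\}}(\log n)^{[\max\{\alpha,\beta\}=2^k]}\bigr). \] Case 2. If $\alpha+\beta=2^k$, then for every $\varepsilon>0$ \[ x(n)=n^k(\log n)\,\Phi(\{\log_2 n\})+n^k\,\Psi(\{\log_2 n\})+O\bigl(n^{\log_2\max\{\alpha,\beta\}+[\alpha=\beta]\varepsilon}\bigr). \] Case 3. If $2^k>\alpha+\beta>2^{k-1}$, then for every $\varepsilon>0$ \[ x(n)=n^k\,\Phi(\{\log_2 n\})+n^{\log_2(\alpha+\beta)}\,\Psi(\{\log_2 n\})+O\bigl(n^{\log_2\max\{\alpha,\beta,2^{k-1}\}+[\max\{\alpha,\beta\}=2^{k-1}]\varepsilon}(\log n)^{[\max\{\alpha,\beta\}<2^{k-1}]}\bigr). \] Case 4. If $2^{k-1}\ge\alpha+\beta$, then \[ x(n)=n^k\,\Phi(\{\log_2 n\})+O\bigl(n^{k-1}(\log n)^E\bigr), \] where \[ E=1+[\alpha+\beta=2^{k-1}]\,\bigl([k\ge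 2\text{ and }c_{k-1}\ne 0]+[k=1\text{ and }d_0+d_1\ne 0]\bigr) \] with $d_0=(1-\beta)x(1)-g(1)+g(0)$ and $d_1=g(1)-(1-\beta)x(1)$. -/

import Mathlib

open Filter Asymptotics

/-- Iverson's bracket: `1` if the statement is true and `0` otherwise. -/
noncomputable def iverson (S : Prop) : ℕ :=
  open Classical in if S then 1 else 0

/-- `x(n) = α x(⌊n/2⌋) + β x(⌈n/2⌉) + g(n)` for `n ≥ 2`; the value `x 0` is not involved
(for natural numbers, `n / 2` is the floor and `n ⌈/⌉ 2` the ceiling of the quotient). -/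
def IsDivideAndConquer (α β : ℝ) (g : Polynomial ℂ) (x : ℕ → ℂ) : Prop :=
  ∀ n : ℕ, 2 ≤ n →
    x n = (α : ℂ) * x (n / 2) + (β : ℂ) * x (n ⌈/⌉ 2) + g.eval (n : ℂ)

/-- Continuous `1`-periodic functions. -/
def IsFluctuation (Φ : ℝ → ℂ) : Prop :=
  Continuous Φ ∧ Function.Periodic Φ 1

/-- `d₀ = (1 - β) x(1) - g(1) + g(0)`. -/
noncomputable def dZero (β : ℝ) (g : Polynomial ℂ) (x : ℕ → ℂ) : ℂ :=
  (1 - (β : ℂ)) * x 1 - g.eval 1 + g.eval 0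

/-- `d₁ = g(1) - (1 - β) x(1)`. -/
noncomputable def dOne (β : ℝ) (g : Polynomial ℂ) (x : ℕ → ℂ) : ℂ :=
  g.eval 1 - (1 - (β : ℂ)) * x 1

/-- The exponent `E` of the logarithm in the case `α + β ≤ 2 ^ (k - 1)`, where `k ≥ 1` is
the degree of `g`. -/
noncomputable def logExponent (α β : ℝ) (k : ℕ) (g : Polynomial ℂ) (x : ℕ → ℂ) : ℕ :=
  1 + iverson (α + β = 2 ^ (k - 1)) *
    (iverson (2 ≤ k ∧ g.coeff (k - 1) ≠ 0) + iverson (k = 1 ∧ dZero β g x + dOne β g x ≠ 0))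

open Set Topology BoundedContinuousFunction in
/-- The de Rham (Salem) distribution function with weight `q`, extended to the real line. -/
theorem exists_deRham (q : ℝ) (hq0 : 0 < q) (hq1 : q < 1) :
    ∃ φ : ℝ → ℝ, Continuous φ ∧ (∀ t, t ≤ 0 → φ t = 0) ∧ (∀ t, 1 ≤ t → φ t = 1) ∧
      (∀ t, φ t ∈ Set.Icc (0 : ℝ) 1) ∧ ∀ t, φ t = q * φ (2 * t) + (1 - q) * φ (2 * t - 1) := by
  let S : Set (ℝ →ᵇ ℝ) :=
    {h | (∀ t, t ≤ 0 → h t = 0) ∧ (∀ t, 1 ≤ t → h t = 1) ∧ ∀ t, h t ∈ Set.Icc (0 : ℝ) 1}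
  have hev : ∀ t : ℝ, Continuous fun h : ℝ →ᵇ ℝ => h t := fun t => continuous_eval_const t
  have hS : IsClosed S := by
    have : S = (⋂ t : ℝ, ⋂ _ : t ≤ 0, {h : ℝ →ᵇ ℝ | h t = 0}) ∩
        ((⋂ t : ℝ, ⋂ _ : 1 ≤ t, {h : ℝ →ᵇ ℝ | h t = 1}) ∩
          ⋂ t : ℝ, (fun h : ℝ →ᵇ ℝ => h t) ⁻¹' Set.Icc 0 1) := by
      ext h; simp [S]
    rw [this]
    refine (isClosed_iInter fun t => isClosed_iInter fun _ =>
      isClosed_eq (hev t) continuous_const).inter ((isClosed_iInter fun t => isClosed_iInter fun _ =>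
      isClosed_eq (hev t) continuous_const).inter (isClosed_iInter fun t => ?_))
    exact isClosed_Icc.preimage (hev t)
  have hT : ∀ h : S, ∃ h' : S, ∀ t, h'.1 t = q * h.1 (2 * t) + (1 - q) * h.1 (2 * t - 1) := by
    rintro ⟨h, h0, h1, hI⟩
    have hmem : ∀ t, q * h (2 * t) + (1 - q) * h (2 * t - 1) ∈ Set.Icc (0 : ℝ) 1 := by
      intro t
      obtain ⟨a0, a1⟩ := hI (2 * t)
      obtain ⟨b0, b1⟩ := hI (2 * t - 1)
      constructor <;> nlinarith
    have hc : Continuous fun t : ℝ => q * h (2 * t) + (1 - q) * h (2 * t - 1) := by fun_prop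
    refine ⟨⟨BoundedContinuousFunction.ofNormedAddCommGroup _ hc 1 fun t => ?_, ?_, ?_, ?_⟩, ?_⟩
    · rw [Real.norm_eq_abs, abs_le]
      exact ⟨by linarith [(hmem t).1], (hmem t).2⟩
    · intro t ht
      simp [h0 (2 * t) (by linarith), h0 (2 * t - 1) (by linarith)]
    · intro t ht
      simp [h1 (2 * t) (by linarith), h1 (2 * t - 1) (by linarith)]
    · exact hmem
    · intro t; rfl
  choose T hT using hT
  have hK : ContractingWith (max q (1 - q)).toNNReal T := by
    have hm0 : 0 ≤ max q (1 - q) := le_max_of_le_left hq0.le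
    refine ⟨?_, LipschitzWith.of_dist_le_mul fun h h' => ?_⟩
    · rw [← NNReal.coe_lt_coe, Real.coe_toNNReal _ hm0]
      exact max_lt hq1 (by simpa using hq0)
    · rw [Real.coe_toNNReal _ hm0, Subtype.dist_eq, BoundedContinuousFunction.dist_le (by positivity)]
      intro t
      rw [hT, hT, Real.dist_eq]
      have hd : ∀ s, |h.1 s - h'.1 s| ≤ dist h h' := fun s => by
        rw [← Real.dist_eq]; exact BoundedContinuousFunction.dist_coe_le_dist s
      rcases le_total (2 * t) 1 with ht | ht
      · rw [h.2.1 (2 * t - 1) (by linarith), h'.2.1 (2 * t - 1) (by linarith)]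
        rw [show q * h.1 (2 * t) + (1 - q) * 0 - (q * h'.1 (2 * t) + (1 - q) * 0)
          = q * (h.1 (2 * t) - h'.1 (2 * t)) by ring, abs_mul, abs_of_pos hq0]
        exact mul_le_mul (le_max_left _ _) (hd _) (abs_nonneg _) hm0
      · rw [h.2.2.1 (2 * t) ht, h'.2.2.1 (2 * t) ht]
        rw [show q * 1 + (1 - q) * h.1 (2 * t - 1) - (q * 1 + (1 - q) * h'.1 (2 * t - 1))
          = (1 - q) * (h.1 (2 * t - 1) - h'.1 (2 * t - 1)) by ring, abs_mul,
          abs_of_pos (by linarith : 0 < 1 - q)]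
        exact mul_le_mul (le_max_right _ _) (hd _) (abs_nonneg _) hm0
  have : CompleteSpace S := hS.completeSpace_coe
  let c : ℝ →ᵇ ℝ := BoundedContinuousFunction.ofNormedAddCommGroup
    (fun t : ℝ => max 0 (min t 1)) (by fun_prop) 1 (fun t => by
      rw [Real.norm_eq_abs, abs_of_nonneg (le_max_left _ _)]
      exact max_le zero_le_one (min_le_right _ _))
  have : Nonempty S := by
    refine ⟨c, fun t ht => ?_, fun t ht => ?_, fun t => ?_⟩
    · change max 0 (min t 1) = 0
      exact max_eq_left ((min_le_left _ _).trans ht)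
    · change max 0 (min t 1) = 1
      rw [min_eq_right ht]; exact max_eq_right zero_le_one
    · exact ⟨le_max_left _ _, max_le zero_le_one (min_le_right _ _)⟩
  let h := ContractingWith.fixedPoint T hK
  have hh : T h = h := hK.fixedPoint_isFixedPt
  refine ⟨h.1, h.1.continuous, h.2.1, h.2.2.1, h.2.2.2, fun t => ?_⟩
  conv_lhs => rw [← hh]
  exact hT h t

/-- Interpolation of a sequence by translates of `φ`. -/
noncomputable def interp (φ : ℝ → ℝ) (a : ℕ → ℂ) (t : ℝ) : ℂ :=
  a 0 + ∑ i ∈ Finset.range ⌈t⌉₊, (a (i + 1) - a i) * (φ (t - i) : ℂ)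

section Interp

variable {φ : ℝ → ℝ}

theorem interp_eq_sum (h0 : ∀ t, t ≤ 0 → φ t = 0) (a : ℕ → ℂ) {t : ℝ} {N : ℕ} (hN : t ≤ N) :
    interp φ a t = a 0 + ∑ i ∈ Finset.range N, (a (i + 1) - a i) * (φ (t - i) : ℂ) := by
  unfold interp
  congr 1
  refine Finset.sum_subset (Finset.range_mono (Nat.ceil_le.2 hN)) fun i _ hi => ?_
  rw [Finset.mem_range, not_lt, Nat.ceil_le] at hi
  rw [h0 _ (by linarith)]; simp

theorem interp_of_mem_Icc (h0 : ∀ t, t ≤ 0 → φ t = 0) (h1 : ∀ t, 1 ≤ t → φ t = 1) (a : ℕ → ℂ)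
    {t : ℝ} {n : ℕ} (hn : (n : ℝ) ≤ t) (hn' : t ≤ n + 1) :
    interp φ a t = a n + (a (n + 1) - a n) * (φ (t - n) : ℂ) := by
  rw [interp_eq_sum h0 a (N := n + 1) (by push_cast; exact hn'), Finset.sum_range_succ, ← add_assoc]
  congr 1
  have : ∑ i ∈ Finset.range n, (a (i + 1) - a i) * (φ (t - i) : ℂ)
      = ∑ i ∈ Finset.range n, (a (i + 1) - a i) := by
    refine Finset.sum_congr rfl fun i hi => ?_
    have : (i : ℝ) + 1 ≤ n := by exact_mod_cast Finset.mem_range.1 hi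
    rw [h1 _ (by linarith)]; simp
  rw [this, Finset.sum_range_sub]; ring

theorem interp_natCast (h0 : ∀ t, t ≤ 0 → φ t = 0) (h1 : ∀ t, 1 ≤ t → φ t = 1) (a : ℕ → ℂ)
    (n : ℕ) : interp φ a n = a n := by
  rw [interp_of_mem_Icc h0 h1 a (le_refl (n : ℝ)) (by linarith), h0 _ (by simp)]; simp

theorem continuous_interp (hφ : Continuous φ) (h0 : ∀ t, t ≤ 0 → φ t = 0) (a : ℕ → ℂ) :
    Continuous (interp φ a) := by
  rw [continuous_iff_continuousAt]
  intro t
  obtain ⟨N, hN⟩ := exists_nat_gt t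
  have hc : Continuous fun s : ℝ =>
      a 0 + ∑ i ∈ Finset.range N, (a (i + 1) - a i) * (φ (s - i) : ℂ) := by fun_prop
  refine hc.continuousAt.congr ?_
  filter_upwards [Iio_mem_nhds hN] with s hs
  exact (interp_eq_sum h0 a (le_of_lt hs)).symm

theorem interp_two_mul (h0 : ∀ t, t ≤ 0 → φ t = 0) (h1 : ∀ t, 1 ≤ t → φ t = 1) {α β : ℝ}
    (hα : 0 < α) (hβ : 0 < β)
    (hφ : ∀ t, φ t = β / (α + β) * φ (2 * t) + (1 - β / (α + β)) * φ (2 * t - 1))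
    {g : Polynomial ℂ} {x : ℕ → ℂ} (hx : IsDivideAndConquer α β g x) {t : ℝ} (ht : 1 ≤ t) :
    interp φ x (2 * t) = ((α + β : ℝ) : ℂ) * interp φ x t
      + interp φ (fun n => g.eval (n : ℂ)) (2 * t) := by
  have hρ : α + β ≠ 0 := by positivity
  have hφ' : ∀ t, (α + β) * φ t = β * φ (2 * t) + α * φ (2 * t - 1) := by
    intro t; rw [hφ t]; field_simp; ring
  set n := ⌊t⌋₊ with hn_def
  have hn1 : 1 ≤ n := (Nat.one_le_floor_iff t).2 ht
  have hnt : (n : ℝ) ≤ t := Nat.floor_le (by linarith)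
  have htn : t ≤ n + 1 := (Nat.lt_floor_add_one t).le
  have e0 : x (2 * n) = (α + β) * x n + g.eval ((2 * n : ℕ) : ℂ) := by
    rw [hx (2 * n) (by omega), Nat.ceilDiv_eq_add_pred_div, show 2 * n / 2 = n by omega,
      show (2 * n + 2 - 1) / 2 = n by omega]; ring
  have e1 : x (2 * n + 1) = α * x n + β * x (n + 1) + g.eval ((2 * n + 1 : ℕ) : ℂ) := by
    rw [hx (2 * n + 1) (by omega), Nat.ceilDiv_eq_add_pred_div, show (2 * n + 1) / 2 = n by omega,
      show (2 * n + 1 + 2 - 1) / 2 = n + 1 by omega]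
  have e2 : x (2 * n + 1 + 1) = (α + β) * x (n + 1) + g.eval ((2 * n + 1 + 1 : ℕ) : ℂ) := by
    rw [hx (2 * n + 1 + 1) (by omega), Nat.ceilDiv_eq_add_pred_div,
      show (2 * n + 1 + 1) / 2 = n + 1 by omega,
      show (2 * n + 1 + 1 + 2 - 1) / 2 = n + 1 by omega]; ring
  have key := hφ' (t - n)
  rw [interp_of_mem_Icc h0 h1 x hnt htn]
  rcases le_total (2 * t) (2 * n + 1) with h | h
  · rw [h0 (2 * (t - n) - 1) (by linarith)] at key
    rw [interp_of_mem_Icc h0 h1 x (n := 2 * n) (by push_cast; linarith) (by push_cast; linarith),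
      interp_of_mem_Icc h0 h1 _ (n := 2 * n) (by push_cast; linarith) (by push_cast; linarith),
      e0, e1]
    have hs : 2 * t - ((2 * n : ℕ) : ℝ) = 2 * (t - n) := by push_cast; ring
    rw [hs]
    have key' : ((α : ℂ) + β) * φ (t - n) = β * φ (2 * (t - n)) := by
      have := congrArg (fun r : ℝ => (r : ℂ)) key
      push_cast at this ⊢; rw [this]; ring
    push_cast
    linear_combination -(x (n + 1) - x n) * key'
  · rw [h1 (2 * (t - n)) (by linarith)] at key
    rw [interp_of_mem_Icc h0 h1 x (n := 2 * n + 1) (by push_cast; linarith)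
        (by push_cast; linarith),
      interp_of_mem_Icc h0 h1 _ (n := 2 * n + 1) (by push_cast; linarith) (by push_cast; linarith),
      e2, e1]
    have hs : 2 * t - ((2 * n + 1 : ℕ) : ℝ) = 2 * (t - n) - 1 := by push_cast; ring
    rw [hs]
    have key' : ((α : ℂ) + β) * φ (t - n) = β + α * φ (2 * (t - n) - 1) := by
      have := congrArg (fun r : ℝ => (r : ℂ)) key
      push_cast at this ⊢; rw [this]; ring
    push_cast
    linear_combination -(x (n + 1) - x n) * key'

end Interp

theorem Polynomial.exists_norm_eval_natCast_le (p : Polynomial ℂ) {d : ℕ} (hp : p.natDegree ≤ d) :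
    ∃ C : ℝ, 0 ≤ C ∧ ∀ m : ℕ, 1 ≤ m → ‖p.eval (m : ℂ)‖ ≤ C * (m : ℝ) ^ d := by
  refine ⟨∑ i ∈ Finset.range (d + 1), ‖p.coeff i‖, by positivity, fun m hm => ?_⟩
  rw [Polynomial.eval_eq_sum_range' (Nat.lt_succ_of_le hp), Finset.sum_mul]
  refine (norm_sum_le _ _).trans (Finset.sum_le_sum fun i hi => ?_)
  rw [norm_mul, norm_pow, Complex.norm_natCast]
  have : (1 : ℝ) ≤ m := by exact_mod_cast hm
  gcongr
  exact Nat.lt_succ_iff.1 (Finset.mem_range.1 hi)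

theorem exists_norm_interp_eval_sub_le {φ : ℝ → ℝ} (h0 : ∀ t, t ≤ 0 → φ t = 0)
    (h1 : ∀ t, 1 ≤ t → φ t = 1) (hI : ∀ t, φ t ∈ Set.Icc (0 : ℝ) 1) {g : Polynomial ℂ} {k : ℕ}
    (hk : 1 ≤ k) (hg : g.natDegree = k) :
    ∃ C : ℝ, 0 ≤ C ∧ ∀ t : ℝ, 1 ≤ t →
      ‖interp φ (fun n => g.eval (n : ℂ)) t - g.coeff k * (t : ℂ) ^ k‖ ≤ C * t ^ (k - 1) := by
  obtain ⟨d, rfl⟩ : ∃ d, k = d + 1 := ⟨k - 1, by omega⟩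
  obtain ⟨C, hC0, hC⟩ := g.eraseLead.exists_norm_eval_natCast_le (d := d)
    ((Polynomial.eraseLead_natDegree_le g).trans (by omega))
  have heval : ∀ m : ℕ, g.eval (m : ℂ) = g.eraseLead.eval (m : ℂ) + g.coeff (d + 1) * m ^ (d + 1) := by
    intro m
    conv_lhs => rw [← g.eraseLead_add_C_mul_X_pow]
    simp [Polynomial.leadingCoeff, hg]
  set c := g.coeff (d + 1)
  set B : ℝ := C * 2 ^ d + ‖c‖ * ((d + 1) * 2 ^ d) with hB
  have hpow : ∀ (m : ℕ) (t : ℝ), 1 ≤ t → 1 ≤ m → (m : ℝ) ≤ 2 * t → |(m : ℝ) - t| ≤ 1 →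
      ‖g.eval (m : ℂ) - c * (t : ℂ) ^ (d + 1)‖ ≤ B * t ^ d := by
    intro m t ht hm hmt habs
    have hm' : (m : ℝ) ^ d ≤ 2 ^ d * t ^ d := by
      rw [← mul_pow]; gcongr
    have hdiff : ‖((m : ℂ) ^ (d + 1) - (t : ℂ) ^ (d + 1))‖ ≤ (d + 1) * 2 ^ d * t ^ d := by
      have : ((m : ℂ) ^ (d + 1) - (t : ℂ) ^ (d + 1)) = (((m : ℝ) ^ (d + 1) - t ^ (d + 1) : ℝ) : ℂ) := by
        push_cast; ring
      rw [this, Complex.norm_real, Real.norm_eq_abs]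
      refine (abs_pow_sub_pow_le (m : ℝ) t (d + 1)).trans ?_
      rw [Nat.add_sub_cancel]
      have hmax : max |(m : ℝ)| |t| ≤ 2 * t := by
        rw [abs_of_nonneg (Nat.cast_nonneg m), abs_of_nonneg (by linarith)]
        exact max_le hmt (by linarith)
      have h3 : max |(m : ℝ)| |t| ^ d ≤ 2 ^ d * t ^ d := by
        rw [← mul_pow]; gcongr
      calc _ ≤ 1 * ((d + 1 : ℕ) : ℝ) * (2 ^ d * t ^ d) := by gcongr
        _ = _ := by push_cast; ring
    rw [heval, add_sub_assoc, ← mul_sub]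
    refine (norm_add_le _ _).trans ?_
    rw [norm_mul]
    calc _ ≤ C * (2 ^ d * t ^ d) + ‖c‖ * ((d + 1) * 2 ^ d * t ^ d) := by
          gcongr
          exact (hC m hm).trans (by gcongr)
      _ = _ := by rw [hB]; ring
  refine ⟨B, by positivity, fun t ht => ?_⟩
  rw [Nat.add_sub_cancel]
  set n := ⌊t⌋₊ with hn_def
  have hn1 : 1 ≤ n := (Nat.one_le_floor_iff t).2 ht
  have hnt : (n : ℝ) ≤ t := Nat.floor_le (by linarith)
  have htn : t ≤ n + 1 := (Nat.lt_floor_add_one t).le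
  rw [interp_of_mem_Icc h0 h1 _ hnt htn]
  obtain ⟨p0, p1⟩ := hI (t - n)
  set p := φ (t - n)
  have hA := hpow n t ht hn1 (by linarith) (by rw [abs_le]; constructor <;> linarith)
  have hA' := hpow (n + 1) t ht (by omega) (by push_cast; linarith)
    (by push_cast; rw [abs_le]; constructor <;> linarith)
  have : g.eval (n : ℂ) + (g.eval ((n + 1 : ℕ) : ℂ) - g.eval (n : ℂ)) * (p : ℂ) - c * (t : ℂ) ^ (d + 1)
      = ((1 - p : ℝ) : ℂ) * (g.eval (n : ℂ) - c * (t : ℂ) ^ (d + 1))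
        + (p : ℂ) * (g.eval ((n + 1 : ℕ) : ℂ) - c * (t : ℂ) ^ (d + 1)) := by
    push_cast; ring
  rw [this]
  refine (norm_add_le _ _).trans ?_
  rw [norm_mul, norm_mul, Complex.norm_real, Complex.norm_real, Real.norm_of_nonneg p0,
    Real.norm_of_nonneg (by linarith : 0 ≤ 1 - p)]
  calc _ ≤ (1 - p) * (B * t ^ d) + p * (B * t ^ d) := by gcongr
    _ = _ := by ring

theorem map_two_pow_mul {ρ : ℝ} {F : ℝ → ℂ} (hF : ∀ t, 1 ≤ t → F (2 * t) = (ρ : ℂ) * F t)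
    {u : ℝ} (hu : 1 ≤ u) (m : ℕ) : F (2 ^ m * u) = (ρ : ℂ) ^ m * F u := by
  induction m with
  | zero => simp
  | succ m ih =>
    have : (1 : ℝ) ≤ 2 ^ m * u := one_le_mul_of_one_le_of_one_le (one_le_pow₀ one_le_two) hu
    rw [pow_succ', mul_assoc, hF _ this, ih, pow_succ']; ring

theorem exists_fluctuation_of_map_two_mul {ρ : ℝ} (hρ : 0 < ρ) {F : ℝ → ℂ}
    (hc : ContinuousOn F (Set.Icc 1 2)) (hF : ∀ t, 1 ≤ t → F (2 * t) = (ρ : ℂ) * F t) :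
    ∃ Φ : ℝ → ℂ, IsFluctuation Φ ∧ ∀ n : ℕ, 1 ≤ n →
      F n = (((n : ℝ) ^ Real.logb 2 ρ : ℝ) : ℂ) * Φ (Int.fract (Real.logb 2 n)) := by
  let Φ₀ : ℝ → ℂ := fun w => ((ρ ^ (-w) : ℝ) : ℂ) * F (2 ^ w)
  refine ⟨Φ₀ ∘ Int.fract, ⟨ContinuousOn.comp_fract'' ?_ ?_, fun v => by simp⟩, fun n hn => ?_⟩
  · refine ContinuousOn.mul (Continuous.continuousOn ?_) (hc.comp (Continuous.continuousOn ?_) ?_)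
    · exact Complex.continuous_ofReal.comp (continuous_const.rpow continuous_neg
        fun _ => Or.inl hρ.ne')
    · exact continuous_const.rpow continuous_id fun _ => Or.inl two_ne_zero
    · intro w hw
      exact ⟨Real.one_le_rpow one_le_two hw.1, by
        simpa using Real.rpow_le_rpow_of_exponent_le one_le_two hw.2⟩
  · have h2 := hF 1 le_rfl
    rw [mul_one] at h2
    simp only [Φ₀, Real.rpow_zero, Real.rpow_one, h2, Real.rpow_neg hρ.le]
    push_cast
    rw [inv_mul_cancel_left₀ (by exact_mod_cast hρ.ne')]; simp
  · have hn1 : (1 : ℝ) ≤ n := by exact_mod_cast hn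
    have hn0 : (0 : ℝ) < n := by linarith
    set l := Real.logb 2 n with hl
    have hl0 : 0 ≤ l := Real.logb_nonneg one_lt_two hn1
    obtain ⟨m, hm⟩ : ∃ m : ℕ, (m : ℤ) = ⌊l⌋ :=
      ⟨⌊l⌋.toNat, Int.toNat_of_nonneg (Int.floor_nonneg.2 hl0)⟩
    set v := Int.fract l with hv
    have hlm : l = m + v := by
      rw [hv, Int.fract, ← hm]; push_cast; ring
    have hnl : (n : ℝ) = 2 ^ m * 2 ^ v := by
      rw [← Real.rpow_natCast, ← Real.rpow_add two_pos, ← hlm, hl,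
        Real.rpow_logb two_pos (by norm_num) hn0]
    have hpow : (n : ℝ) ^ Real.logb 2 ρ = ρ ^ m * ρ ^ v := by
      rw [← Real.rpow_natCast, ← Real.rpow_add hρ, ← hlm, hl]
      conv_lhs => rw [← Real.rpow_logb two_pos (by norm_num) hn0, ← Real.rpow_mul two_pos.le,
        mul_comm, Real.rpow_mul two_pos.le, Real.rpow_logb two_pos (by norm_num) hρ]
    have hv1 : (1 : ℝ) ≤ 2 ^ v := Real.one_le_rpow one_le_two (Int.fract_nonneg l)
    have hρv : (ρ ^ v : ℝ) ≠ 0 := (Real.rpow_pos_of_pos hρ v).ne'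
    rw [hpow, Function.comp_apply, Int.fract_eq_self.2 ⟨Int.fract_nonneg l, Int.fract_lt_one l⟩,
      hnl, map_two_pow_mul hF hv1]
    simp only [Φ₀, Real.rpow_neg hρ.le]
    have : ((ρ ^ v : ℝ) : ℂ) ≠ 0 := by exact_mod_cast hρv
    rw [← hv]
    push_cast
    field_simp

theorem exists_fluctuation_isBigO {ρ : ℝ} {d : ℕ} (hρ : (2 : ℝ) ^ d < ρ) {Q R : ℝ → ℂ}
    (hQ : ContinuousOn Q (Set.Ici 1)) (hR : ContinuousOn R (Set.Ici 1))
    (hQR : ∀ t, 1 ≤ t → Q (2 * t) = (ρ : ℂ) * Q t + R (2 * t))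
    {C : ℝ} (hC0 : 0 ≤ C) (hC : ∀ t, 1 ≤ t → ‖R t‖ ≤ C * t ^ d) :
    ∃ Φ : ℝ → ℂ, IsFluctuation Φ ∧
      (fun n : ℕ => Q n - (((n : ℝ) ^ Real.logb 2 ρ : ℝ) : ℂ) * Φ (Int.fract (Real.logb 2 n)))
        =O[atTop] fun n : ℕ => (n : ℝ) ^ d := by
  have hρ0 : 0 < ρ := lt_trans (by positivity) hρ
  have hρc : (ρ : ℂ) ≠ 0 := by exact_mod_cast hρ0.ne'
  set r : ℝ := 2 ^ d / ρ with hr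
  have hr0 : 0 ≤ r := by positivity
  have hr1 : r < 1 := (div_lt_one hρ0).2 hρ
  let T : ℕ → ℝ → ℂ := fun j t => ((ρ : ℂ) ^ (j + 1))⁻¹ * R (2 ^ (j + 1) * t)
  have h2 : ∀ (j : ℕ) {t : ℝ}, 1 ≤ t → (1 : ℝ) ≤ 2 ^ j * t := fun j t ht =>
    one_le_mul_of_one_le_of_one_le (one_le_pow₀ one_le_two) ht
  have hT : ∀ j t, 1 ≤ t → ‖T j t‖ ≤ C * t ^ d * r ^ j := by
    intro j t ht
    have : ‖T j t‖ ≤ C * t ^ d * r ^ (j + 1) := by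
      simp only [T, norm_mul, norm_inv, norm_pow, Complex.norm_real, Real.norm_of_nonneg hρ0.le]
      calc _ ≤ (ρ ^ (j + 1))⁻¹ * (C * (2 ^ (j + 1) * t) ^ d) := by
            gcongr; exact hC _ (h2 _ ht)
        _ = _ := by rw [hr, mul_pow, div_pow, ← pow_mul, ← pow_mul, mul_comm d]; field_simp
    refine this.trans ?_
    have : r ^ (j + 1) ≤ r ^ j := pow_le_pow_of_le_one hr0 hr1.le (Nat.le_succ j)
    have : 0 ≤ t ^ d := by positivity
    gcongr
  have hg : Summable fun j => r ^ j := summable_geometric_of_lt_one hr0 hr1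
  have hTs : ∀ t, 1 ≤ t → Summable fun j => T j t := fun t ht =>
    Summable.of_norm_bounded (hg.mul_left (C * t ^ d)) fun j => hT j t ht
  let H : ℝ → ℂ := fun t => ∑' j, T j t
  have hHc : ContinuousOn H (Set.Icc 1 2) := by
    refine continuousOn_tsum (u := fun j => C * 2 ^ d * r ^ j) (fun j => ?_)
      (hg.mul_left _) fun j t ht => (hT j t ht.1).trans ?_
    · refine continuousOn_const.mul (hR.comp (by fun_prop) fun t ht => h2 _ ht.1)
    · have : 0 ≤ t := by linarith [ht.1]
      have := ht.2
      gcongr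
  have hH2 : ∀ t, 1 ≤ t → H (2 * t) = ρ * H t - R (2 * t) := by
    intro t ht
    have e : ∀ j, T j (2 * t) = ρ * T (j + 1) t := by
      intro j
      simp only [T]
      rw [pow_succ (ρ : ℂ) (j + 1), show (2 : ℝ) ^ (j + 1) * (2 * t) = 2 ^ (j + 1 + 1) * t by ring]
      field_simp
    have e0 : T 0 t = (ρ : ℂ)⁻¹ * R (2 * t) := by simp [T]
    change ∑' j, T j (2 * t) = ρ * ∑' j, T j t - R (2 * t)
    rw [(hTs t ht).tsum_eq_zero_add, e0]
    simp only [e, tsum_mul_left]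
    field_simp; ring
  obtain ⟨Φ, hΦ, hΦn⟩ := exists_fluctuation_of_map_two_mul hρ0 (F := fun t => Q t + H t)
    ((hQ.mono Set.Icc_subset_Ici_self).add hHc) fun t ht => by
      simp only [hH2 t ht, hQR t ht]; ring
  refine ⟨Φ, hΦ, IsBigO.of_bound (C * (1 - r)⁻¹) ?_⟩
  filter_upwards [eventually_ge_atTop 1] with n hn
  have hn1 : (1 : ℝ) ≤ n := by exact_mod_cast hn
  rw [← hΦn n hn, sub_add_cancel_left, norm_neg, Real.norm_of_nonneg (by positivity)]
  have := tsum_of_norm_bounded ((hasSum_geometric_of_lt_one hr0 hr1).mul_left (C * (n : ℝ) ^ d))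
    fun j => hT j n hn1
  calc _ ≤ _ := this
    _ = _ := by ring

theorem isBigO_pow_mul_log_of_map_two_mul {ρ : ℝ} {d : ℕ} (hρ0 : 0 ≤ ρ) (hρ : ρ ≤ (2 : ℝ) ^ d)
    {Q R : ℝ → ℂ} (hQ : ContinuousOn Q (Set.Ici 1))
    (hQR : ∀ t, 1 ≤ t → Q (2 * t) = (ρ : ℂ) * Q t + R (2 * t))
    {C : ℝ} (hC : ∀ t, 1 ≤ t → ‖R t‖ ≤ C * t ^ d) :
    (fun n : ℕ => Q n) =O[atTop] fun n : ℕ => (n : ℝ) ^ d * Real.log n := by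
  obtain ⟨B, hB⟩ := isCompact_Icc.exists_bound_of_continuousOn
    (hQ.mono fun t (ht : t ∈ Set.Icc (1 : ℝ) 2) => ht.1)
  set A := max C B
  have hA0 : 0 ≤ A := le_trans ((norm_nonneg _).trans (hB 1 (by norm_num))) (le_max_right _ _)
  have key : ∀ (m : ℕ) (t : ℝ), 1 ≤ t → t ≤ 2 ^ (m + 1) →
      ‖Q t‖ ≤ A * t ^ d * (1 + Real.logb 2 t) := by
    intro m
    have base : ∀ t : ℝ, 1 ≤ t → t ≤ 2 → ‖Q t‖ ≤ A * t ^ d * (1 + Real.logb 2 t) := by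
      intro t ht ht2
      have h1 : 1 ≤ t ^ d := one_le_pow₀ ht
      have h2 : 0 ≤ Real.logb 2 t := Real.logb_nonneg one_lt_two ht
      calc ‖Q t‖ ≤ A := (hB t ⟨ht, ht2⟩).trans (le_max_right _ _)
        _ ≤ A * (t ^ d * (1 + Real.logb 2 t)) :=
          le_mul_of_one_le_right hA0 (one_le_mul_of_one_le_of_one_le h1 (by linarith))
        _ = _ := by ring
    induction m with
    | zero => intro t ht ht2; exact base t ht (by simpa using ht2)
    | succ m ih =>
      intro t ht htm
      rcases le_total t 2 with h | h
      · exact base t ht h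
      · obtain ⟨s, rfl⟩ : ∃ s, t = 2 * s := ⟨t / 2, by ring⟩
        have hs : 1 ≤ s := by linarith
        have h3 := ih s hs (by rw [pow_succ' _ (m + 1)] at htm; linarith)
        have hl : Real.logb 2 (2 * s) = 1 + Real.logb 2 s := by
          rw [Real.logb_mul two_ne_zero (by linarith), Real.logb_self_eq_one one_lt_two]
        have hl0 : 0 ≤ Real.logb 2 s := Real.logb_nonneg one_lt_two hs
        rw [hQR s hs, hl]
        refine (norm_add_le _ _).trans ?_
        rw [norm_mul, Complex.norm_real, Real.norm_of_nonneg hρ0]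
        calc _ ≤ 2 ^ d * (A * s ^ d * (1 + Real.logb 2 s)) + A * (2 * s) ^ d := by
              gcongr
              exact (hC _ ht).trans (by gcongr; exact le_max_left _ _)
          _ = _ := by rw [mul_pow]; ring
  refine IsBigO.of_bound (A * (2 / Real.log 2)) ?_
  filter_upwards [eventually_ge_atTop 2] with n hn
  have hn2 : (2 : ℝ) ≤ n := by exact_mod_cast hn
  have hlog2 : 0 < Real.log 2 := Real.log_pos one_lt_two
  have hlog : Real.log 2 ≤ Real.log n := Real.log_le_log two_pos hn2
  have h := key n n (by linarith) (by
    exact_mod_cast (Nat.lt_two_pow_self.le.trans (Nat.pow_le_pow_right two_pos (Nat.le_succ n))))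
  have h4 : 1 + Real.logb 2 n ≤ 2 / Real.log 2 * Real.log n := by
    rw [Real.logb, div_mul_eq_mul_div, ← sub_nonneg]
    have : 2 * Real.log n / Real.log 2 - (1 + Real.log n / Real.log 2)
      = (Real.log n - Real.log 2) / Real.log 2 := by field_simp; ring
    rw [this]; exact div_nonneg (by linarith) hlog2.le
  rw [Real.norm_of_nonneg (by have := hlog2.le.trans hlog; positivity)]
  calc _ ≤ _ := h
    _ ≤ A * (n : ℝ) ^ d * (2 / Real.log 2 * Real.log n) := by gcongr
    _ = _ := by ring

theorem isFluctuation_const (c : ℂ) : IsFluctuation fun _ => c :=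
  ⟨continuous_const, fun _ => rfl⟩

theorem isBigO_pow_rpow_mul_log {d : ℕ} {e : ℝ} (h : (d : ℝ) ≤ e) (j : ℕ) :
    (fun n : ℕ => (n : ℝ) ^ d) =O[atTop] fun n : ℕ => (n : ℝ) ^ e * Real.log n ^ j := by
  refine IsBigO.of_bound 1 ?_
  filter_upwards [eventually_ge_atTop 3] with n hn
  have hn3 : (3 : ℝ) ≤ n := by exact_mod_cast hn
  have hlog : 1 ≤ Real.log n := by
    rw [Real.le_log_iff_exp_le (by linarith)]
    linarith [Real.exp_one_lt_three]
  have hj : 1 ≤ Real.log n ^ j := one_le_pow₀ hlog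
  have he : (n : ℝ) ^ d ≤ (n : ℝ) ^ e := by
    rw [← Real.rpow_natCast]
    exact Real.rpow_le_rpow_of_exponent_le (by linarith) h
  rw [Real.norm_of_nonneg (by positivity), Real.norm_of_nonneg (by positivity), one_mul]
  exact he.trans (le_mul_of_one_le_right (by positivity) hj)

theorem natCast_le_logb_two {d : ℕ} {M : ℝ} (h : (2 : ℝ) ^ d ≤ M) : (d : ℝ) ≤ Real.logb 2 M := by
  rw [Real.le_logb_iff_rpow_le one_lt_two (lt_of_lt_of_le (by positivity) h), Real.rpow_natCast]
  exact h

/-- A divide-and-conquer sequence extends to a continuous function on the real line whose dyadic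
functional equation has the leading monomial of `g` as toll function, up to lower order. -/
theorem IsDivideAndConquer.exists_extension {α β : ℝ} (hα : 0 < α) (hβ : 0 < β) {k : ℕ}
    (hk : 1 ≤ k) {g : Polynomial ℂ} (hg : g.natDegree = k) {x : ℕ → ℂ}
    (hx : IsDivideAndConquer α β g x) :
    ∃ f R : ℝ → ℂ, Continuous f ∧ Continuous R ∧ (∀ n : ℕ, f n = x n) ∧
      (∀ t : ℝ, 1 ≤ t → f (2 * t) = ((α + β : ℝ) : ℂ) * f t + R (2 * t)
        + g.coeff k * (2 * (t : ℂ)) ^ k) ∧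
      ∃ C : ℝ, 0 ≤ C ∧ ∀ t : ℝ, 1 ≤ t → ‖R t‖ ≤ C * t ^ (k - 1) := by
  obtain ⟨φ, hφc, h0, h1, hI, hφ⟩ := exists_deRham (β / (α + β)) (by positivity)
    ((div_lt_one (by positivity)).2 (by linarith))
  refine ⟨interp φ x, fun t => interp φ (fun n => g.eval (n : ℂ)) t - g.coeff k * (t : ℂ) ^ k,
    continuous_interp hφc h0 x, (continuous_interp hφc h0 _).sub (by fun_prop),
    interp_natCast h0 h1 x, fun t ht => ?_, exists_norm_interp_eval_sub_le h0 h1 hI hk hg⟩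
  rw [interp_two_mul h0 h1 hα hβ hφ hx ht]
  push_cast; ring

theorem IsDivideAndConquer.exists_isBigO_of_ne {α β : ℝ} (hα : 0 < α) (hβ : 0 < β) {k : ℕ}
    (hk : 1 ≤ k) {g : Polynomial ℂ} (hg : g.natDegree = k) {x : ℕ → ℂ}
    (hx : IsDivideAndConquer α β g x) (hne : α + β ≠ 2 ^ k) (hlt : (2 : ℝ) ^ (k - 1) < α + β) :
    ∃ (c : ℂ) (Φ : ℝ → ℂ), IsFluctuation Φ ∧
      (fun n : ℕ => x n - ((n : ℂ) ^ k * c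
        + (((n : ℝ) ^ Real.logb 2 (α + β) : ℝ) : ℂ) * Φ (Int.fract (Real.logb 2 n))))
        =O[atTop] fun n : ℕ => (n : ℝ) ^ (k - 1) := by
  obtain ⟨f, R, hf, hR, hfx, hfR, C, hC0, hC⟩ := hx.exists_extension hα hβ hk hg
  have hne' : (2 : ℂ) ^ k - ((α + β : ℝ) : ℂ) ≠ 0 := by
    rw [sub_ne_zero]; exact_mod_cast hne.symm
  set c : ℂ := g.coeff k * 2 ^ k / (2 ^ k - ((α + β : ℝ) : ℂ)) with hc
  have hc' : c * (2 ^ k - ((α + β : ℝ) : ℂ)) = g.coeff k * 2 ^ k := div_mul_cancel₀ _ hne'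
  obtain ⟨Φ, hΦ, h⟩ := exists_fluctuation_isBigO hlt (Q := fun t => f t - (t : ℂ) ^ k * c)
    (Continuous.continuousOn (by fun_prop)) hR.continuousOn (fun t ht => by
      simp only [hfR t ht, Complex.ofReal_mul, Complex.ofReal_ofNat, mul_pow]
      linear_combination -(t : ℂ) ^ k * hc') hC0 hC
  refine ⟨c, Φ, hΦ, h.congr_left fun n => ?_⟩
  simp only [hfx, Complex.ofReal_natCast]; ring

theorem IsDivideAndConquer.exists_isBigO_of_eq {α β : ℝ} (hα : 0 < α) (hβ : 0 < β) {k : ℕ}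
    (hk : 1 ≤ k) {g : Polynomial ℂ} (hg : g.natDegree = k) {x : ℕ → ℂ}
    (hx : IsDivideAndConquer α β g x) (heq : α + β = 2 ^ k) :
    ∃ (c : ℂ) (Ψ : ℝ → ℂ), IsFluctuation Ψ ∧
      (fun n : ℕ => x n - ((n : ℂ) ^ k * (Real.log n : ℂ) * c
        + (n : ℂ) ^ k * Ψ (Int.fract (Real.logb 2 n))))
        =O[atTop] fun n : ℕ => (n : ℝ) ^ (k - 1) := by
  obtain ⟨f, R, hf, hR, hfx, hfR, C, hC0, hC⟩ := hx.exists_extension hα hβ hk hg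
  rw [heq] at hfR
  have hlt : (2 : ℝ) ^ (k - 1) < 2 ^ k := pow_lt_pow_right₀ one_lt_two (by omega)
  have hlog2 : (Real.log 2 : ℂ) ≠ 0 := by exact_mod_cast (Real.log_pos one_lt_two).ne'
  set c : ℂ := g.coeff k / Real.log 2 with hc
  have hc' : c * Real.log 2 = g.coeff k := div_mul_cancel₀ _ hlog2
  obtain ⟨Ψ, hΨ, h⟩ := exists_fluctuation_isBigO hlt
    (Q := fun t => f t - (t : ℂ) ^ k * (Real.log t : ℂ) * c) (by
      refine hf.continuousOn.sub (ContinuousOn.mul (ContinuousOn.mul (by fun_prop) ?_) (by fun_prop))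
      refine Complex.continuous_ofReal.comp_continuousOn (Real.continuousOn_log.mono ?_)
      intro t ht
      exact (lt_of_lt_of_le one_pos ht).ne') hR.continuousOn (fun t ht => by
      rw [Real.log_mul two_ne_zero (by linarith)]
      simp only [hfR t ht, Complex.ofReal_mul, Complex.ofReal_ofNat, Complex.ofReal_add,
        Complex.ofReal_pow, mul_pow]
      linear_combination -(2 : ℂ) ^ k * (t : ℂ) ^ k * hc') hC0 hC
  refine ⟨c, Ψ, hΨ, h.congr_left fun n => ?_⟩
  have : Real.logb 2 ((2 : ℝ) ^ k) = k := by
    rw [← Real.rpow_natCast, Real.logb_rpow two_pos (by norm_num)]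
  simp only [hfx, Complex.ofReal_natCast, this, Real.rpow_natCast, Complex.ofReal_pow]; ring

theorem IsDivideAndConquer.exists_isBigO_of_le {α β : ℝ} (hα : 0 < α) (hβ : 0 < β) {k : ℕ}
    (hk : 1 ≤ k) {g : Polynomial ℂ} (hg : g.natDegree = k) {x : ℕ → ℂ}
    (hx : IsDivideAndConquer α β g x) (hle : α + β ≤ 2 ^ (k - 1)) :
    ∃ c : ℂ, (fun n : ℕ => x n - (n : ℂ) ^ k * c)
        =O[atTop] fun n : ℕ => (n : ℝ) ^ (k - 1) * Real.log n := by
  obtain ⟨f, R, hf, hR, hfx, hfR, C, hC0, hC⟩ := hx.exists_extension hα hβ hk hg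
  have hlt : α + β < (2 : ℝ) ^ k := hle.trans_lt (pow_lt_pow_right₀ one_lt_two (by omega))
  have hne' : (2 : ℂ) ^ k - ((α + β : ℝ) : ℂ) ≠ 0 := by
    rw [sub_ne_zero]; exact_mod_cast hlt.ne'
  set c : ℂ := g.coeff k * 2 ^ k / (2 ^ k - ((α + β : ℝ) : ℂ)) with hc
  have hc' : c * (2 ^ k - ((α + β : ℝ) : ℂ)) = g.coeff k * 2 ^ k := div_mul_cancel₀ _ hne'
  have h := isBigO_pow_mul_log_of_map_two_mul (by positivity) hle
    (Q := fun t => f t - (t : ℂ) ^ k * c)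
    (Continuous.continuousOn (by fun_prop)) (fun t ht => by
      simp only [hfR t ht, Complex.ofReal_mul, Complex.ofReal_ofNat, mul_pow]
      linear_combination -(t : ℂ) ^ k * hc') hC
  refine ⟨c, h.congr_left fun n => ?_⟩
  simp only [hfx, Complex.ofReal_natCast]

theorem mainTheorem2 (α β : ℝ) (hα : 0 < α) (hβ : 0 < β)
    (k : ℕ) (hk : 1 ≤ k) (g : Polynomial ℂ) (hg : g.natDegree = k)
    (x : ℕ → ℂ) (hx : IsDivideAndConquer α β g x) :
    -- Case 1a
    ((2 : ℝ) ^ k < α + β → max α β < (2 : ℝ) ^ k →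
      ∃ Φ Ψ : ℝ → ℂ, IsFluctuation Φ ∧ IsFluctuation Ψ ∧
        (fun n : ℕ => x n -
          ((((n : ℝ) ^ Real.logb 2 (α + β) : ℝ) : ℂ) * Φ (Int.fract (Real.logb 2 n))
            + (n : ℂ) ^ k * Ψ (Int.fract (Real.logb 2 n))))
        =O[atTop] fun n : ℕ => (n : ℝ) ^ Real.logb 2 (max α β)) ∧
    -- Case 1b
    ((2 : ℝ) ^ k < α + β → (2 : ℝ) ^ k ≤ max α β →
      ∃ Φ : ℝ → ℂ, IsFluctuation Φ ∧
        (fun n : ℕ => x n -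
          (((n : ℝ) ^ Real.logb 2 (α + β) : ℝ) : ℂ) * Φ (Int.fract (Real.logb 2 n)))
        =O[atTop] fun n : ℕ => (n : ℝ) ^ Real.logb 2 (max α β)
          * Real.log n ^ iverson (max α β = (2 : ℝ) ^ k)) ∧
    -- Case 2
    (α + β = (2 : ℝ) ^ k →
      ∃ Φ Ψ : ℝ → ℂ, IsFluctuation Φ ∧ IsFluctuation Ψ ∧ ∀ ε : ℝ, 0 < ε →
        (fun n : ℕ => x n -
          ((n : ℂ) ^ k * (Real.log n : ℂ) * Φ (Int.fract (Real.logb 2 n))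
            + (n : ℂ) ^ k * Ψ (Int.fract (Real.logb 2 n))))
        =O[atTop] fun n : ℕ =>
          (n : ℝ) ^ (Real.logb 2 (max α β) + (iverson (α = β) : ℝ) * ε)) ∧
    -- Case 3
    (α + β < (2 : ℝ) ^ k → (2 : ℝ) ^ (k - 1) < α + β →
      ∃ Φ Ψ : ℝ → ℂ, IsFluctuation Φ ∧ IsFluctuation Ψ ∧ ∀ ε : ℝ, 0 < ε →
        (fun n : ℕ => x n -
          ((n : ℂ) ^ k * Φ (Int.fract (Real.logb 2 n))
            + (((n : ℝ) ^ Real.logb 2 (α + β) : ℝ) : ℂ) * Ψ (Int.fract (Real.logb 2 n))))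
        =O[atTop] fun n : ℕ =>
          (n : ℝ) ^ (Real.logb 2 (max (max α β) ((2 : ℝ) ^ (k - 1)))
              + (iverson (max α β = (2 : ℝ) ^ (k - 1)) : ℝ) * ε)
            * Real.log n ^ iverson (max α β < (2 : ℝ) ^ (k - 1))) ∧
    -- Case 4
    (α + β ≤ (2 : ℝ) ^ (k - 1) →
      ∃ Φ : ℝ → ℂ, IsFluctuation Φ ∧
        (fun n : ℕ => x n - (n : ℂ) ^ k * Φ (Int.fract (Real.logb 2 n)))
        =O[atTop] fun n : ℕ =>
          (n : ℝ) ^ (k - 1) * Real.log n ^ logExponent α β k g x) := by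
  have hk2 : (2 : ℝ) ^ k = 2 * 2 ^ (k - 1) := by
    rw [← pow_succ']; congr 1; omega
  have hp : (0 : ℝ) < 2 ^ (k - 1) := by positivity
  have hmax : α + β ≤ 2 * max α β := by
    linarith [le_max_left α β, le_max_right α β]
  refine ⟨fun h1 _ => ?_, fun h1 h2 => ?_, fun h => ?_, fun h1 h2 => ?_, fun h => ?_⟩
  · obtain ⟨c, Φ, hΦ, h⟩ := hx.exists_isBigO_of_ne hα hβ hk hg h1.ne' (by linarith)
    refine ⟨Φ, fun _ => c, hΦ, isFluctuation_const c,
      (h.congr_left fun n => by ring).trans ?_⟩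
    simpa using isBigO_pow_rpow_mul_log
      (natCast_le_logb_two (d := k - 1) (M := max α β) (by linarith)) 0
  · obtain ⟨c, Φ, hΦ, h⟩ := hx.exists_isBigO_of_ne hα hβ hk hg h1.ne' (by linarith)
    have hle := natCast_le_logb_two h2
    have hle' : ((k - 1 : ℕ) : ℝ) ≤ k := by exact_mod_cast Nat.sub_le k 1
    have hc : (fun n : ℕ => (n : ℂ) ^ k * c) =O[atTop] fun n : ℕ => (n : ℝ) ^ k :=
      IsBigO.of_bound ‖c‖ (Eventually.of_forall fun n => by simp [mul_comm])
    refine ⟨Φ, hΦ, ((h.trans (isBigO_pow_rpow_mul_log (hle'.trans hle) _)).add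
      (hc.trans (isBigO_pow_rpow_mul_log hle _))).congr_left fun n => by ring⟩
  · obtain ⟨c, Ψ, hΨ, hO⟩ := hx.exists_isBigO_of_eq hα hβ hk hg h
    refine ⟨fun _ => c, Ψ, isFluctuation_const c, hΨ, fun ε hε => hO.trans ?_⟩
    have hle := natCast_le_logb_two (d := k - 1) (M := max α β) (by linarith)
    have hε' : 0 ≤ (iverson (α = β) : ℝ) * ε := by positivity
    simpa using isBigO_pow_rpow_mul_log (hle.trans (le_add_of_nonneg_right hε')) 0
  · obtain ⟨c, Φ, hΦ, h⟩ := hx.exists_isBigO_of_ne hα hβ hk hg h1.ne h2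
    refine ⟨fun _ => c, Φ, isFluctuation_const c, hΦ, fun ε hε => h.trans ?_⟩
    have hle := natCast_le_logb_two (le_max_right (max α β) ((2 : ℝ) ^ (k - 1)))
    exact isBigO_pow_rpow_mul_log (hle.trans (le_add_of_nonneg_right (by positivity))) _
  · obtain ⟨c, hc⟩ := hx.exists_isBigO_of_le hα hβ hk hg h
    refine ⟨fun _ => c, isFluctuation_const c, hc.trans (IsBigO.of_bound 1 ?_)⟩
    filter_upwards [eventually_ge_atTop 3] with n hn
    have hn3 : (3 : ℝ) ≤ n := by exact_mod_cast hn
    have hlog : 1 ≤ Real.log n := by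
      rw [Real.le_log_iff_exp_le (by linarith)]
      linarith [Real.exp_one_lt_three]
    rw [Real.norm_of_nonneg (by positivity), Real.norm_of_nonneg (by positivity), one_mul]
    gcongr
    exact le_self_pow₀ hlog (by unfold logExponent; omega)
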